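/- Let $(I_p)$, indexed by the prime numbers $p$, be independent random variables on a probability space, with $\mathbb P(I_p=1)=1/p$ and $\mathbb P(I_p=0)=1-1/p$ for every prime $p$. Then for every real $s>0$ the random series $$S_{\mathrm{primes}}:=\sum_{p\ \mathrm{prime}}\frac{I_p}{p^s}$$ converges almost surely, and the distribution $\mu$ of $S_{\mathrm{primes}}$ is non-atomic (that is, $\mu(\{x\})=0$ for every $x\in\mathbb R$) and singular with respect to Lebesgue measure on $\mathbb R$. -/

import Mathlib

open MeasureTheory ProbabilityTheory

noncomputable section

/-- The number `1 / p`, for a prime `p`, as an element of the unit interval. -/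
def primeProb (p : Nat.Primes) : unitInterval :=
  ⟨1 / ((p : ℕ) : ℝ), by positivity,
    div_le_one_of_le₀ (by exact_mod_cast p.2.one_lt.le) (by positivity)⟩

/-- The random series `∑_p I_p / p ^ s`, over all primes `p`. -/
def primeSeries {Ω : Type*} (I : Nat.Primes → Ω → ℝ) (s : ℝ) (ω : Ω) : ℝ :=
  ∑' p : Nat.Primes, I p ω / ((p : ℕ) : ℝ) ^ s

end

/-!
Write the series as `∑_p J_p p ^ (-s)`. It converges almost surely because its expectation
`∑_p p ^ (-1 - s)` is finite (`IsBernoulliFamily.ae_summable`).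

*No atoms* (`IsBernoulliFamily.measureReal_tsum_eq_zero`). If the sum had an atom, every late tail
would take some value `c` with probability above `3 / 4`
(`IsBernoulliFamily.eventually_exists_tail_concentrated`). Each late term vanishes with
probability at least `3 / 4`, so `c` does not change when one more term is removed, and since the
tails tend to `0`, it is `0`. But a tail vanishes only if all its terms do, which has probability
`∏_p (1 - 1 / p) = 0`.

*Singularity* (`IsBernoulliFamily.ae_mem_limsup_primeCover`). Call `p` selected if `J_p = 1`. For
fixed `K`, with a probability bounded below independently of `N`, the selected primes up to `N`
have product at most `N ^ 6`, and no prime in `(N, N ^ K]` is selected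
(`le_measureReal_gapEvent`). By Kolmogorov's zero-one law this happens almost surely for
infinitely many `N`. For `K` large compared with `1 / s`, the tail over the primes beyond `N ^ K`
is eventually below `N ^ (-8)`. So the sum lies, for infinitely many `N`, in one of at most
`N ^ 6 + 1` intervals of length `N ^ (-8)`, and the set of such points is Lebesgue null. The only
input on the distribution of primes is `∑_{p ≤ N} log p / p ≤ 2 log N`.
-/

open Filter
open scoped Topology ENNReal

/-! ### Sums over primes -/

/-- A weak form of Mertens' first theorem: the exponent of `p` in `N!` is at least `N / p` rounded
down, hence at least `N / (2 * p)`, while `N! ≤ N ^ N`. -/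
theorem sum_log_div_primesLE_le (N : ℕ) :
    ∑ p ∈ N.primesLE, Real.log p / p ≤ 2 * Real.log N := by
  rcases Nat.eq_zero_or_pos N with rfl | hN
  · simp [Nat.primesLE]
  have hdvd : ∏ p ∈ N.primesLE, p ^ (N / p) ∣ N.factorial := by
    apply Finset.prod_dvd_of_isRelPrime
    · intro p hp q hq hpq
      have hp' := Nat.mem_primesLE.1 hp
      have hq' := Nat.mem_primesLE.1 hq
      exact Nat.coprime_iff_isRelPrime.1 (Nat.Coprime.pow _ _
        ((Nat.coprime_primes hp'.2 hq'.2).2 hpq))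
    · intro p hp
      have hp' := Nat.mem_primesLE.1 hp
      refine dvd_trans (dvd_trans ?_
        (Nat.prod_factorial_dvd_factorial_sum (Finset.range (N / p)) fun _ => p)) ?_
      · rw [Finset.prod_const, Finset.card_range]
        exact pow_dvd_pow_of_dvd (Nat.dvd_factorial hp'.2.pos le_rfl) _
      · simp only [Finset.sum_const, Finset.card_range, smul_eq_mul]
        exact Nat.factorial_dvd_factorial (Nat.div_mul_le_self N p)
  have hle : ∏ p ∈ N.primesLE, p ^ (N / p) ≤ N ^ N :=
    (Nat.le_of_dvd (Nat.factorial_pos N) hdvd).trans (Nat.factorial_le_pow N)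
  have hlog : ∑ p ∈ N.primesLE, ((N / p : ℕ) : ℝ) * Real.log p ≤ N * Real.log N := by
    have h1 : (((∏ p ∈ N.primesLE, p ^ (N / p) : ℕ)) : ℝ) ≤ ((N ^ N : ℕ) : ℝ) := by
      exact_mod_cast hle
    have hpos : 0 < ∏ p ∈ N.primesLE, p ^ (N / p) :=
      Finset.prod_pos fun p hp => pow_pos (Nat.mem_primesLE.1 hp).2.pos _
    have h2 := Real.log_le_log (by exact_mod_cast hpos) h1
    push_cast at h2
    rw [Real.log_prod, Real.log_pow] at h2
    · simpa only [Real.log_pow] using h2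
    · intro p hp
      have := (Nat.mem_primesLE.1 hp).2.pos
      positivity
  have hN' : (0 : ℝ) < N := by exact_mod_cast hN
  have key : ∑ p ∈ N.primesLE, (N / 2 : ℝ) * (Real.log p / p) ≤
      ∑ p ∈ N.primesLE, ((N / p : ℕ) : ℝ) * Real.log p := by
    refine Finset.sum_le_sum fun p hp => ?_
    obtain ⟨hpN, hp⟩ := Nat.mem_primesLE.1 hp
    have hp0 : (0 : ℝ) < p := by exact_mod_cast hp.pos
    have h1 : N ≤ 2 * (N / p) * p := by
      have h3 := Nat.div_add_mod N p
      have h4 := Nat.mod_lt N hp.pos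
      have h5 : 1 ≤ N / p := Nat.div_pos hpN hp.pos
      nlinarith
    have h2 : (N : ℝ) ≤ 2 * ((N / p : ℕ) : ℝ) * p := by exact_mod_cast h1
    have h6 : (N / 2 : ℝ) / p ≤ ((N / p : ℕ) : ℝ) := by
      rw [div_le_iff₀ hp0]; linarith
    have h7 : 0 ≤ Real.log p := Real.log_natCast_nonneg p
    calc (N / 2 : ℝ) * (Real.log p / p) = (N / 2 : ℝ) / p * Real.log p := by ring
      _ ≤ _ := mul_le_mul_of_nonneg_right h6 h7
  rw [← Finset.mul_sum] at key
  nlinarith [key.trans hlog]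

/-- The reciprocals of the primes in `(N, N ^ K]` have sum at most `2 * K`, since each of them
is at most `log p / p` divided by `log N`. -/
theorem sum_inv_primes_Ioc_pow_le {N : ℕ} (hN : 2 ≤ N) (K : ℕ) :
    ∑ p ∈ (N ^ K).primesLE.filter (N < ·), (1 : ℝ) / p ≤ 2 * K := by
  have hlogN : 0 < Real.log N := Real.log_pos (by exact_mod_cast hN)
  have h1 : ∑ p ∈ (N ^ K).primesLE.filter (N < ·), Real.log N * ((1 : ℝ) / p) ≤
      ∑ p ∈ (N ^ K).primesLE, Real.log p / p := by
    refine (Finset.sum_le_sum fun p hp => ?_).trans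
      (Finset.sum_le_sum_of_subset_of_nonneg (Finset.filter_subset _ _) fun p _ _ => ?_)
    · have hNp := (Finset.mem_filter.1 hp).2
      rw [mul_one_div]
      gcongr
    · exact div_nonneg (Real.log_natCast_nonneg p) (Nat.cast_nonneg p)
  have h2 := h1.trans (sum_log_div_primesLE_le (N ^ K))
  rw [← Finset.mul_sum] at h2
  push_cast at h2
  rw [Real.log_pow] at h2
  by_contra! h
  nlinarith

/-- The primes `p` with `m < p ≤ n`, as a finite set in `Nat.Primes`. -/
def primesIoc (m n : ℕ) : Finset Nat.Primes :=
  (n.primesLE.filter (m < ·)).subtype Nat.Prime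

theorem mem_primesIoc {m n : ℕ} {p : Nat.Primes} :
    p ∈ primesIoc m n ↔ m < (p : ℕ) ∧ (p : ℕ) ≤ n := by
  have h : p ∈ primesIoc m n ↔ (p : ℕ) ∈ n.primesLE.filter (m < ·) := Finset.mem_subtype
  rw [h, Finset.mem_filter, Nat.mem_primesLE]
  exact ⟨fun h => ⟨h.2, h.1.1⟩, fun h => ⟨⟨h.2, p.2⟩, h.1⟩⟩

theorem sum_primesIoc (m n : ℕ) (f : ℕ → ℝ) :
    ∑ p ∈ primesIoc m n, f p = ∑ p ∈ n.primesLE.filter (m < ·), f p :=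
  Finset.sum_subtype_of_mem f fun _ hp => (Nat.mem_primesLE.1 (Finset.mem_filter.1 hp).1).2

theorem sum_log_primesIoc_le (m N : ℕ) :
    ∑ p ∈ primesIoc m N, Real.log (p : ℕ) / (p : ℕ) ≤ 2 * Real.log N := by
  rw [sum_primesIoc m N fun p => Real.log p / p]
  exact (Finset.sum_le_sum_of_subset_of_nonneg (Finset.filter_subset _ _) fun p _ _ =>
    div_nonneg (Real.log_natCast_nonneg p) (Nat.cast_nonneg p)).trans (sum_log_div_primesLE_le N)

/-- The primes up to `log₂ N` have product at most `4 ^ log₂ N ≤ N ^ 2`. -/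
theorem sum_log_primesIoc_log_le {N : ℕ} (hN : 1 ≤ N) :
    ∑ p ∈ primesIoc 0 (Nat.log 2 N), Real.log (p : ℕ) ≤ 2 * Real.log N := by
  rw [sum_primesIoc 0 _ fun p => Real.log p]
  have h0 : (Nat.log 2 N).primesLE.filter (0 < ·) = (Nat.log 2 N).primesLE :=
    Finset.filter_true_of_mem fun p hp => (Nat.mem_primesLE.1 hp).2.pos
  rw [h0, ← Chebyshev.theta_eq_sum_primesLE_log]
  refine (Chebyshev.theta_le_log4_mul_x (Nat.cast_nonneg _)).trans ?_
  have h1 : ((2 ^ Nat.log 2 N : ℕ) : ℝ) ≤ N := by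
    exact_mod_cast Nat.pow_log_le_self 2 (by lia)
  have h2 := Real.log_le_log (by positivity) h1
  rw [Nat.cast_pow, Real.log_pow] at h2
  have h4 : Real.log 4 = 2 * Real.log 2 := by
    rw [show (4 : ℝ) = 2 ^ 2 by norm_num, Real.log_pow]; norm_num
  push_cast at h2
  rw [h4]
  linarith

/-! ### Bernoulli families and subseries -/

/-- Independent measurable random variables with values in `{0, 1}` (everywhere, not just almost
surely), the `i`-th one being `1` with probability `q i`. -/
structure IsBernoulliFamily {ι Ω : Type*} [MeasurableSpace Ω] (J : ι → Ω → ℝ) (q : ι → ℝ)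
    (P : Measure Ω) : Prop where
  measurable : ∀ i, Measurable (J i)
  zero_or_one : ∀ i ω, J i ω = 0 ∨ J i ω = 1
  measureReal_one : ∀ i, P.real {ω | J i ω = 1} = q i
  indep : iIndepFun J P

/-- The σ-algebra generated by the variables `J i` with `i ∈ A`. -/
@[reducible]
def blockSigma {ι Ω : Type*} (J : ι → Ω → ℝ) (A : Set ι) : MeasurableSpace Ω :=
  ⨆ i ∈ A, MeasurableSpace.comap (J i) inferInstance

/-- The part `∑_{i ∈ A} J i * a i` of the series, with the junk value `0` where it diverges. -/
noncomputable def subSeries {ι Ω : Type*} (J : ι → Ω → ℝ) (a : ι → ℝ) (A : Set ι) (ω : Ω) : ℝ :=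
  ∑' i, A.indicator (fun i => J i ω * a i) i

section
variable {ι Ω : Type*} {J : ι → Ω → ℝ} {a q : ι → ℝ} {A B : Set ι}

theorem blockSigma_mono (h : A ⊆ B) : blockSigma J A ≤ blockSigma J B :=
  biSup_mono h

theorem measurable_blockSigma {i : ι} (hi : i ∈ A) : Measurable[blockSigma J A] (J i) :=
  Measurable.of_comap_le (le_biSup (fun i => MeasurableSpace.comap (J i) inferInstance) hi)

theorem measurable_blockSigma_subSeries [Countable ι] (a : ι → ℝ)
    (A : Set ι) : Measurable[blockSigma J A] (subSeries J a A) := by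
  let _ := blockSigma J A
  refine Measurable.tsum fun i => ?_
  by_cases hi : i ∈ A
  · simp only [Set.indicator_of_mem hi]
    exact Measurable.mul_const (measurable_blockSigma hi) (a i)
  · simp only [Set.indicator_of_notMem hi]
    exact measurable_const

theorem measurableSet_blockSigma_eq {i : ι} (hi : i ∈ A) (x : ℝ) :
    MeasurableSet[blockSigma J A] {ω | J i ω = x} :=
  measurable_blockSigma hi (measurableSet_singleton x)

theorem subSeries_add_compl {ω : Ω} (hω : Summable fun i => J i ω * a i) (A : Set ι) :
    subSeries J a A ω + subSeries J a Aᶜ ω = ∑' i, J i ω * a i := by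
  rw [subSeries, subSeries, ← (hω.indicator A).tsum_add (hω.indicator Aᶜ)]
  exact tsum_congr fun i => congrFun (Set.indicator_self_add_compl A fun i => J i ω * a i) i

theorem subSeries_compl_insert [DecidableEq ι] {ω : Ω} {i : ι} (hi : J i ω = 0) (F : Finset ι) :
    subSeries J a ((insert i F : Finset ι) : Set ι)ᶜ ω = subSeries J a (F : Set ι)ᶜ ω := by
  refine tsum_congr fun j => ?_
  by_cases hj : j = i
  · subst hj
    simp [Set.indicator, hi]
  · simp [Set.indicator, hj]

variable [MeasurableSpace Ω] {P : Measure Ω}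

namespace IsBernoulliFamily

theorem blockSigma_le (h : IsBernoulliFamily J q P) (A : Set ι) :
    blockSigma J A ≤ ‹MeasurableSpace Ω› :=
  iSup₂_le fun i _ => (h.measurable i).comap_le

theorem indep_blockSigma (h : IsBernoulliFamily J q P) (hAB : Disjoint A B) :
    Indep (blockSigma J A) (blockSigma J B) P :=
  indep_iSup_of_disjoint (fun i => (h.measurable i).comap_le) h.indep.iIndep hAB

theorem measurableSet_eq (h : IsBernoulliFamily J q P) (i : ι) (x : ℝ) :
    MeasurableSet {ω | J i ω = x} :=
  h.measurable i (measurableSet_singleton x)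

theorem nonneg (h : IsBernoulliFamily J q P) (i : ι) (ω : Ω) : 0 ≤ J i ω := by
  rcases h.zero_or_one i ω with h | h <;> simp [h]

theorem prob_nonneg (h : IsBernoulliFamily J q P) (i : ι) : 0 ≤ q i :=
  h.measureReal_one i ▸ measureReal_nonneg

theorem indicator_nonneg (h : IsBernoulliFamily J q P) (ha : ∀ i, 0 ≤ a i) (A : Set ι) (ω : Ω)
    (i : ι) : 0 ≤ A.indicator (fun i => J i ω * a i) i :=
  Set.indicator_nonneg (fun i _ => mul_nonneg (h.nonneg i ω) (ha i)) i

/-- This holds off the set of convergence too: there the real `tsum` is `0`, and so is the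
`toReal` of the sum `∞`. -/
theorem subSeries_eq_toReal (h : IsBernoulliFamily J q P) (ha : ∀ i, 0 ≤ a i) (A : Set ι) (ω : Ω) :
    subSeries J a A ω =
      (∑' i, ENNReal.ofReal (A.indicator (fun i => J i ω * a i) i)).toReal := by
  rw [ENNReal.tsum_toReal_eq fun _ => ENNReal.ofReal_ne_top]
  exact tsum_congr fun i => (ENNReal.toReal_ofReal (h.indicator_nonneg ha A ω i)).symm

theorem subSeries_nonneg (h : IsBernoulliFamily J q P) (ha : ∀ i, 0 ≤ a i) (A : Set ι) (ω : Ω) :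
    0 ≤ subSeries J a A ω :=
  tsum_nonneg (h.indicator_nonneg ha A ω)

theorem measurable_subSeries [Countable ι] (h : IsBernoulliFamily J q P) (a : ι → ℝ) (A : Set ι) :
    Measurable (subSeries J a A) :=
  (measurable_blockSigma_subSeries a A).mono (h.blockSigma_le A) le_rfl

theorem lintegral_tsum_indicator [Countable ι] [IsFiniteMeasure P] (h : IsBernoulliFamily J q P)
    (a : ι → ℝ) (A : Set ι) :
    ∫⁻ ω, ∑' i, ENNReal.ofReal (A.indicator (fun i => J i ω * a i) i) ∂P =
      ∑' i, ENNReal.ofReal (A.indicator (fun i => q i * a i) i) := by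
  have hm : ∀ i, Measurable fun ω => ENNReal.ofReal (A.indicator (fun i => J i ω * a i) i) := by
    intro i
    by_cases hi : i ∈ A
    · simp only [Set.indicator_of_mem hi]
      exact ((h.measurable i).mul_const _).ennreal_ofReal
    · simp only [Set.indicator_of_notMem hi]
      exact measurable_const
  rw [lintegral_tsum fun i => (hm i).aemeasurable]
  refine tsum_congr fun i => ?_
  by_cases hi : i ∈ A
  · simp only [Set.indicator_of_mem hi]
    have h1 : ∀ ω, ENNReal.ofReal (J i ω * a i) =
        {ω | J i ω = 1}.indicator (fun _ => ENNReal.ofReal (a i)) ω := by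
      intro ω
      rcases h.zero_or_one i ω with h | h <;> simp [h]
    simp only [h1]
    rw [lintegral_indicator_const (h.measurableSet_eq i 1),
      ENNReal.ofReal_mul (h.prob_nonneg i), ← h.measureReal_one i, ofReal_measureReal, mul_comm]
  · simp [Set.indicator_of_notMem hi]

theorem ae_summable [Countable ι] [IsFiniteMeasure P] (h : IsBernoulliFamily J q P)
    (ha : ∀ i, 0 ≤ a i) (hqa : Summable fun i => q i * a i) :
    ∀ᵐ ω ∂P, Summable fun i => J i ω * a i := by
  have h1 := h.lintegral_tsum_indicator a Set.univ
  simp only [Set.indicator_univ] at h1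
  have h2 : ∫⁻ ω, ∑' i, ENNReal.ofReal (J i ω * a i) ∂P ≠ ∞ := by
    rw [h1]
    exact hqa.tsum_ofReal_ne_top
  have hm : Measurable fun ω => ∑' i, ENNReal.ofReal (J i ω * a i) :=
    Measurable.tsum fun i => ((h.measurable i).mul_const _).ennreal_ofReal
  filter_upwards [ae_lt_top hm h2] with ω hω
  have := ENNReal.summable_toReal hω.ne
  refine this.congr fun i => ?_
  rw [ENNReal.toReal_ofReal (mul_nonneg (h.nonneg i ω) (ha i))]

/-- Markov's inequality for a subseries. -/
theorem measureReal_le_subSeries_le [Countable ι] [IsFiniteMeasure P]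
    (h : IsBernoulliFamily J q P) (ha : ∀ i, 0 ≤ a i) (A : Set ι)
    (hqa : Summable (A.indicator fun i => q i * a i)) {ε : ℝ} (hε : 0 < ε) :
    P.real {ω | ε ≤ subSeries J a A ω} ≤ (∑' i, A.indicator (fun i => q i * a i) i) / ε := by
  have hnn : ∀ i, 0 ≤ A.indicator (fun i => q i * a i) i := fun i =>
    Set.indicator_nonneg (fun i _ => mul_nonneg (h.prob_nonneg i) (ha i)) i
  have h1 : ∫⁻ ω, ENNReal.ofReal (subSeries J a A ω) ∂P ≤
      ENNReal.ofReal (∑' i, A.indicator (fun i => q i * a i) i) := by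
    rw [ENNReal.ofReal_tsum_of_nonneg hnn hqa, ← h.lintegral_tsum_indicator a A]
    refine lintegral_mono fun ω => ?_
    rw [h.subSeries_eq_toReal ha A ω]
    exact ENNReal.ofReal_toReal_le
  have h2 := mul_meas_ge_le_lintegral (μ := P) (h.measurable_subSeries a A).ennreal_ofReal
    (ENNReal.ofReal ε)
  have h3 : {ω | ENNReal.ofReal ε ≤ ENNReal.ofReal (subSeries J a A ω)} =
      {ω | ε ≤ subSeries J a A ω} := by
    ext ω
    exact ENNReal.ofReal_le_ofReal_iff (h.subSeries_nonneg ha A ω)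
  rw [h3] at h2
  rw [le_div_iff₀ hε, mul_comm]
  have h4 := ENNReal.toReal_mono ENNReal.ofReal_ne_top (h2.trans h1)
  rwa [ENNReal.toReal_mul, ENNReal.toReal_ofReal hε.le,
    ENNReal.toReal_ofReal (tsum_nonneg hnn)] at h4

theorem measureReal_zero [IsProbabilityMeasure P] (h : IsBernoulliFamily J q P) (i : ι) :
    P.real {ω | J i ω = 0} = 1 - q i := by
  have : {ω | J i ω = 0} = {ω | J i ω = 1}ᶜ := by
    ext ω
    rcases h.zero_or_one i ω with h | h <;> simp [h]
  rw [this, probReal_compl_eq_one_sub (h.measurableSet_eq i 1),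
    h.measureReal_one]

theorem measureReal_forall_zero [IsProbabilityMeasure P] (h : IsBernoulliFamily J q P)
    (F : Finset ι) : P.real {ω | ∀ i ∈ F, J i ω = 0} = ∏ i ∈ F, (1 - q i) := by
  have h1 := h.indep.measure_inter_preimage_eq_mul F (sets := fun _ => {0})
    fun i _ => measurableSet_singleton 0
  have h2 : {ω | ∀ i ∈ F, J i ω = 0} = ⋂ i ∈ F, J i ⁻¹' {0} := by ext; simp
  rw [h2, measureReal_def, h1, ENNReal.toReal_prod]
  exact Finset.prod_congr rfl fun i _ => h.measureReal_zero i

end IsBernoulliFamily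

end

/-! ### Absence of atoms -/

/-- If `Y` takes no value with probability above `c`, then an independent `X` cannot bring the
conditional probability of `X + Y = x`, given `X ∈ U`, above `c` either. -/
theorem measureReal_mem_and_add_eq_le {Ω : Type*} [MeasurableSpace Ω] {P : Measure Ω}
    [IsProbabilityMeasure P] {X Y : Ω → ℝ} (hX : Measurable X) (hY : Measurable Y)
    (hXY : IndepFun X Y P) {c : ℝ} (hc : ∀ y, P.real {ω | Y ω = y} ≤ c) {U : Set ℝ}
    (hU : MeasurableSet U) (x : ℝ) :
    P.real {ω | X ω ∈ U ∧ X ω + Y ω = x} ≤ c * P.real {ω | X ω ∈ U} := by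
  have hc0 : 0 ≤ c := measureReal_nonneg.trans (hc 0)
  have hprod := (indepFun_iff_map_prod_eq_prod_map_map hX.aemeasurable hY.aemeasurable).1 hXY
  have hV : MeasurableSet {z : ℝ × ℝ | z.1 ∈ U ∧ z.1 + z.2 = x} :=
    (measurable_fst hU).inter ((measurable_fst.add measurable_snd) (measurableSet_singleton x))
  have : IsProbabilityMeasure (P.map X) := Measure.isProbabilityMeasure_map hX.aemeasurable
  have : IsProbabilityMeasure (P.map Y) := Measure.isProbabilityMeasure_map hY.aemeasurable
  have h1 : P {ω | X ω ∈ U ∧ X ω + Y ω = x} ≤ ENNReal.ofReal c * P {ω | X ω ∈ U} := by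
    have h2 : {ω | X ω ∈ U ∧ X ω + Y ω = x} =
        (fun ω => (X ω, Y ω)) ⁻¹' {z : ℝ × ℝ | z.1 ∈ U ∧ z.1 + z.2 = x} := rfl
    rw [h2, ← Measure.map_apply (hX.prodMk hY) hV, hprod, Measure.prod_apply hV]
    calc ∫⁻ t, (P.map Y) (Prod.mk t ⁻¹' {z : ℝ × ℝ | z.1 ∈ U ∧ z.1 + z.2 = x}) ∂(P.map X)
        ≤ ∫⁻ t, U.indicator (fun _ => ENNReal.ofReal c) t ∂(P.map X) := by
          refine lintegral_mono fun t => ?_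
          by_cases ht : t ∈ U
          · rw [Set.indicator_of_mem ht]
            have h3 : Prod.mk t ⁻¹' {z : ℝ × ℝ | z.1 ∈ U ∧ z.1 + z.2 = x} = {x - t} := by
              ext y
              simp only [Set.mem_preimage, Set.mem_ofPred_eq, Set.mem_singleton_iff, ht, true_and]
              constructor <;> intro h <;> linarith
            rw [h3, Measure.map_apply hY (measurableSet_singleton _)]
            exact (ENNReal.le_ofReal_iff_toReal_le (measure_ne_top _ _) hc0).2 (hc (x - t))
          · have h3 : Prod.mk t ⁻¹' {z : ℝ × ℝ | z.1 ∈ U ∧ z.1 + z.2 = x} = ∅ := by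
              ext y; simp [ht]
            simp [h3]
      _ = ENNReal.ofReal c * P {ω | X ω ∈ U} := by
          rw [lintegral_indicator_const hU, Measure.map_apply hX hU]
          rfl
  have h4 := ENNReal.toReal_mono
    (ENNReal.mul_ne_top ENNReal.ofReal_ne_top (measure_ne_top _ _)) h1
  rwa [ENNReal.toReal_mul, ENNReal.toReal_ofReal hc0] at h4

theorem exists_measureReal_punctured_lt {Ω : Type*} [MeasurableSpace Ω] {P : Measure Ω}
    [IsProbabilityMeasure P] {X : Ω → ℝ} (hX : Measurable X) (x : ℝ) {ε : ℝ} (hε : 0 < ε) :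
    ∃ δ > 0, P.real {ω | X ω ≠ x ∧ |X ω - x| < δ} < ε := by
  have hmeas : ∀ n : ℕ, MeasurableSet {ω | X ω ≠ x ∧ |X ω - x| < 1 / ((n : ℝ) + 1)} := fun n =>
    (hX (measurableSet_singleton x).compl).inter
      (measurableSet_lt (hX.sub_const x).abs measurable_const)
  have hanti : Antitone fun n : ℕ => {ω | X ω ≠ x ∧ |X ω - x| < 1 / ((n : ℝ) + 1)} :=
    fun m n hmn ω hω => ⟨hω.1, hω.2.trans_le (Nat.one_div_le_one_div hmn)⟩
  have hlim := tendsto_measure_iInter_atTop (μ := P) (fun n => (hmeas n).nullMeasurableSet) hanti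
    ⟨0, measure_ne_top _ _⟩
  have hempty : ⋂ n : ℕ, {ω | X ω ≠ x ∧ |X ω - x| < 1 / ((n : ℝ) + 1)} = ∅ := by
    refine Set.eq_empty_of_forall_notMem fun ω hω => ?_
    rw [Set.mem_iInter] at hω
    obtain ⟨n, hn⟩ := exists_nat_one_div_lt (abs_pos.2 (sub_ne_zero.2 (hω 0).1))
    exact lt_asymm hn (hω n).2
  rw [hempty, measure_empty] at hlim
  obtain ⟨n, hn⟩ := ((tendsto_order.1 hlim).2 (ENNReal.ofReal ε) (by simpa using hε)).exists
  exact ⟨1 / ((n : ℝ) + 1), by positivity,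
    (ENNReal.lt_ofReal_iff_toReal_lt (measure_ne_top _ _)).1 hn⟩

theorem exists_mem_inter_three {Ω : Type*} [MeasurableSpace Ω] {P : Measure Ω}
    [IsProbabilityMeasure P] {s t u : Set Ω} (hs : MeasurableSet s)
    (ht : MeasurableSet t) (hst : 3 / 4 < P.real s) (htt : 3 / 4 < P.real t)
    (hu : MeasurableSet u) (hut : 3 / 4 ≤ P.real u) : ∃ ω, ω ∈ s ∧ ω ∈ t ∧ ω ∈ u := by
  by_contra! hcon
  have hsub : (Set.univ : Set Ω) ⊆ (sᶜ ∪ tᶜ) ∪ uᶜ := by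
    intro ω _
    by_contra hω
    simp only [Set.mem_union, Set.mem_compl_iff, not_or, not_not] at hω
    exact hcon ω hω.1.1 hω.1.2 hω.2
  have h1 := (measureReal_mono (μ := P) hsub).trans (measureReal_union_le _ _)
  have h2 := measureReal_union_le (μ := P) sᶜ tᶜ
  rw [probReal_univ] at h1
  rw [probReal_compl_eq_one_sub hs, probReal_compl_eq_one_sub ht] at h2
  rw [probReal_compl_eq_one_sub hu] at h1
  linarith

namespace IsBernoulliFamily

variable {ι Ω : Type*} [Countable ι] {J : ι → Ω → ℝ} {a q : ι → ℝ} [MeasurableSpace Ω]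
  {P : Measure Ω} [IsProbabilityMeasure P]

theorem tendsto_measureReal_tail (h : IsBernoulliFamily J q P) (ha : ∀ i, 0 ≤ a i)
    (hqa : Summable fun i => q i * a i) {δ : ℝ} (hδ : 0 < δ) :
    Tendsto (fun F : Finset ι => P.real {ω | δ ≤ subSeries J a (F : Set ι)ᶜ ω}) atTop (𝓝 0) := by
  have h1 := (tendsto_tsum_compl_atTop_zero fun i => q i * a i).div_const δ
  rw [zero_div] at h1
  refine squeeze_zero (fun _ => measureReal_nonneg) (fun F => ?_) h1
  refine (h.measureReal_le_subSeries_le ha _ (hqa.indicator _) hδ).trans_eq ?_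
  rw [← tsum_subtype]
  rfl

/-- If `x` is an atom of the sum, then every late tail takes some value with probability above
`3 / 4`. When a finite partial sum is close to `x` and its tail is small, the whole sum is close to
`x`, hence most likely equal to `x`; so the tail most likely equals the difference, and it is
independent of the partial sum. -/
theorem eventually_exists_tail_concentrated (h : IsBernoulliFamily J q P) (ha : ∀ i, 0 ≤ a i)
    (hqa : Summable fun i => q i * a i) {x : ℝ} (hx : 0 < P.real {ω | ∑' i, J i ω * a i = x}) :
    ∀ᶠ F : Finset ι in atTop, ∃ c, 3 / 4 < P.real {ω | subSeries J a (F : Set ι)ᶜ ω = c} := by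
  set m := P.real {ω | ∑' i, J i ω * a i = x} with hm
  have hSmeas : Measurable fun ω => ∑' i, J i ω * a i :=
    Measurable.tsum fun i => (h.measurable i).mul_const _
  obtain ⟨δ, hδ, hpunc⟩ := exists_measureReal_punctured_lt (P := P) hSmeas x
    (show 0 < m / 20 by positivity)
  filter_upwards [(tendsto_order.1 (h.tendsto_measureReal_tail ha hqa (half_pos hδ))).2 (m / 20)
    (by positivity)] with F hF
  by_contra! hcon
  set T := subSeries J a (F : Set ι) with hT
  set R := subSeries J a (F : Set ι)ᶜ with hR
  have hTm : Measurable T := h.measurable_subSeries a _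
  have hRm : Measurable R := h.measurable_subSeries a _
  have hTR : IndepFun T R P := by
    have := h.indep_blockSigma (A := (F : Set ι)) (B := (F : Set ι)ᶜ) disjoint_compl_right
    rw [IndepFun_iff_Indep]
    exact indep_of_indep_of_le_right (indep_of_indep_of_le_left this
      (measurable_blockSigma_subSeries a _).comap_le) (measurable_blockSigma_subSeries a _).comap_le
  have hU : MeasurableSet {t : ℝ | |t - x| < δ / 2} :=
    measurableSet_lt (measurable_id.sub_const x).abs measurable_const
  have hkey := measureReal_mem_and_add_eq_le hTm hRm hTR hcon hU x
  simp only [Set.mem_ofPred_eq] at hkey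
  -- up to a null set, the sum is `T + R`
  have hae : ∀ᵐ ω ∂P, T ω + R ω = ∑' i, J i ω * a i := by
    filter_upwards [h.ae_summable ha hqa] with ω hω
    exact subSeries_add_compl hω _
  have hnull : P.real {ω | T ω + R ω = ∑' i, J i ω * a i}ᶜ = 0 := by
    rw [measureReal_def, mem_ae_iff.1 hae, ENNReal.toReal_zero]
  -- at the atom, the partial sum is close to `x` unless the tail is large
  have hlow : m ≤ P.real {ω | |T ω - x| < δ / 2} + P.real {ω | δ / 2 ≤ R ω} := by
    have hsub : {ω | ∑' i, J i ω * a i = x} ⊆ ({ω | |T ω - x| < δ / 2} ∪ {ω | δ / 2 ≤ R ω}) ∪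
        {ω | T ω + R ω = ∑' i, J i ω * a i}ᶜ := by
      intro ω hω
      by_cases h1 : T ω + R ω = ∑' i, J i ω * a i
      · left
        rcases le_or_gt (δ / 2) (R ω) with h2 | h2
        · exact Or.inr h2
        · left
          have h3 : 0 ≤ R ω := h.subSeries_nonneg ha _ ω
          have h4 : T ω + R ω = x := h1.trans hω
          rw [Set.mem_ofPred_eq, abs_lt]
          constructor <;> linarith
      · exact Or.inr h1
    have h5 := (measureReal_mono (μ := P) hsub).trans (measureReal_union_le _ _)
    have h6 := measureReal_union_le (μ := P) {ω | |T ω - x| < δ / 2} {ω | δ / 2 ≤ R ω}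
    linarith
  -- conversely, a partial sum close to `x` most likely means that the sum is equal to `x`
  have hup : P.real {ω | |T ω - x| < δ / 2} ≤
      P.real {ω | |T ω - x| < δ / 2 ∧ T ω + R ω = x} + (P.real {ω | δ / 2 ≤ R ω} +
        P.real {ω | ∑' i, J i ω * a i ≠ x ∧ |(∑' i, J i ω * a i) - x| < δ}) := by
    have hsub : {ω | |T ω - x| < δ / 2} ⊆ ({ω | |T ω - x| < δ / 2 ∧ T ω + R ω = x} ∪
        ({ω | δ / 2 ≤ R ω} ∪
        {ω | ∑' i, J i ω * a i ≠ x ∧ |(∑' i, J i ω * a i) - x| < δ})) ∪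
        {ω | T ω + R ω = ∑' i, J i ω * a i}ᶜ := by
      intro ω hω
      by_cases h1 : T ω + R ω = ∑' i, J i ω * a i
      · left
        by_cases h7 : T ω + R ω = x
        · exact Or.inl ⟨hω, h7⟩
        rcases le_or_gt (δ / 2) (R ω) with h2 | h2
        · exact Or.inr (Or.inl h2)
        · right; right
          have h3 : 0 ≤ R ω := h.subSeries_nonneg ha _ ω
          rw [Set.mem_ofPred_eq, abs_lt] at hω
          rw [Set.mem_ofPred_eq, ← h1, abs_lt]
          exact ⟨h7, by linarith, by linarith⟩
      · exact Or.inr h1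
    have h5 := (measureReal_mono (μ := P) hsub).trans (measureReal_union_le _ _)
    have h6 := measureReal_union_le (μ := P) {ω | |T ω - x| < δ / 2 ∧ T ω + R ω = x}
      ({ω | δ / 2 ≤ R ω} ∪ {ω | ∑' i, J i ω * a i ≠ x ∧ |(∑' i, J i ω * a i) - x| < δ})
    have h7 := measureReal_union_le (μ := P) {ω | δ / 2 ≤ R ω}
      {ω | ∑' i, J i ω * a i ≠ x ∧ |(∑' i, J i ω * a i) - x| < δ}
    linarith
  linarith

/-- **Lévy's criterion** for the absence of atoms, for series of independent two-valued terms. -/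
theorem measureReal_tsum_eq_zero (h : IsBernoulliFamily J q P) (ha : ∀ i, 0 < a i)
    (hqa : Summable fun i => q i * a i) (hq : ¬ Summable q) (hq0 : Tendsto q cofinite (𝓝 0))
    (x : ℝ) : P.real {ω | ∑' i, J i ω * a i = x} = 0 := by
  classical
  by_contra hne
  have ha' : ∀ i, 0 ≤ a i := fun i => (ha i).le
  obtain ⟨F₁, hF₁⟩ := eventually_atTop.1 (h.eventually_exists_tail_concentrated ha' hqa
    (lt_of_le_of_ne measureReal_nonneg (Ne.symm hne)))
  have hfin : {i | ¬ q i < 1 / 4}.Finite := (tendsto_order.1 hq0).2 (1 / 4) (by norm_num)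
  set F₀ := F₁ ∪ hfin.toFinset with hF₀
  have hRm : ∀ (F : Finset ι) (c : ℝ), MeasurableSet {ω | subSeries J a (F : Set ι)ᶜ ω = c} :=
    fun F c => h.measurable_subSeries a _ (measurableSet_singleton c)
  obtain ⟨c, hc⟩ := hF₁ F₀ Finset.subset_union_left
  -- the likely value cannot change when one more term, itself likely to vanish, is removed
  have hconst : ∀ G : Finset ι,
      3 / 4 < P.real {ω | subSeries J a ((F₀ ∪ G : Finset ι) : Set ι)ᶜ ω = c} := by
    intro G
    induction G using Finset.induction_on with
    | empty => simpa using hc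
    | insert i G hiG ih =>
      rw [Finset.union_insert]
      by_cases hi : i ∈ F₀ ∪ G
      · rwa [Finset.insert_eq_of_mem hi]
      obtain ⟨c', hc'⟩ := hF₁ (insert i (F₀ ∪ G)) ((Finset.subset_union_left.trans
        Finset.subset_union_left).trans (Finset.subset_insert _ _))
      have hqi : q i < 1 / 4 := by
        by_contra hcon
        exact hi (Finset.mem_union_left _ (Finset.mem_union_right _ (hfin.mem_toFinset.2 hcon)))
      obtain ⟨ω, h1, h2, h3⟩ := exists_mem_inter_three (hRm _ _) (hRm _ _) ih hc'
        (h.measurableSet_eq i 0) (by rw [h.measureReal_zero]; linarith)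
      have h4 := subSeries_compl_insert (a := a) h3 (F₀ ∪ G)
      have h5 : c' = c := by
        rw [← show _ = c' from h2, ← show _ = c from h1, h4]
      rwa [← h5]
  -- the tails tend to `0` in probability
  have hc0 : c = 0 := by
    by_contra hc0
    have hc_nonneg : 0 ≤ c := by
      have : {ω | subSeries J a (F₀ : Set ι)ᶜ ω = c}.Nonempty := by
        by_contra hemp
        rw [Set.not_nonempty_iff_eq_empty.1 hemp, measureReal_empty] at hc
        norm_num at hc
      obtain ⟨ω, hω⟩ := this
      exact hω ▸ h.subSeries_nonneg ha' _ ω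
    have hcpos : 0 < c := lt_of_le_of_ne hc_nonneg (Ne.symm hc0)
    obtain ⟨F₂, hF₂⟩ := eventually_atTop.1 ((tendsto_order.1
      (h.tendsto_measureReal_tail ha' hqa hcpos)).2 (3 / 4) (by norm_num))
    have h1 := hF₂ (F₀ ∪ F₂) Finset.subset_union_right
    have h2 := hconst F₂
    have h3 : P.real {ω | subSeries J a ((F₀ ∪ F₂ : Finset ι) : Set ι)ᶜ ω = c} ≤
        P.real {ω | c ≤ subSeries J a ((F₀ ∪ F₂ : Finset ι) : Set ι)ᶜ ω} :=
      measureReal_mono fun ω hω => (show _ = c from hω).ge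
    linarith
  subst hc0
  -- a vanishing tail has all its terms zero, which the divergence of `∑ q` forbids
  refine hq ?_
  have hprod : ∀ G : Finset ι, Disjoint G F₀ → 3 / 4 ≤ Real.exp (-∑ i ∈ G, q i) := by
    intro G hG
    have hsub : {ω | subSeries J a (F₀ : Set ι)ᶜ ω = 0} ⊆ {ω | ∀ i ∈ G, J i ω = 0} ∪
        {ω | Summable fun i => J i ω * a i}ᶜ := by
      intro ω hω
      by_cases hs : Summable fun i => J i ω * a i
      · left
        intro i hi
        have hnn := h.indicator_nonneg ha' (F₀ : Set ι)ᶜ ω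
        have hsum : HasSum ((F₀ : Set ι)ᶜ.indicator fun i => J i ω * a i) 0 := by
          rw [← show subSeries J a (F₀ : Set ι)ᶜ ω = 0 from hω]
          exact (hs.indicator (F₀ : Set ι)ᶜ).hasSum
        have h1 := congrFun ((hasSum_zero_iff_of_nonneg hnn).1 hsum) i
        rw [Set.indicator_of_mem (by simpa using Finset.disjoint_left.1 hG hi)] at h1
        exact (mul_eq_zero.1 h1).resolve_right (ha i).ne'
      · exact Or.inr hs
    have hnull : P.real {ω | Summable fun i => J i ω * a i}ᶜ = 0 := by
      rw [measureReal_def, mem_ae_iff.1 (h.ae_summable ha' hqa), ENNReal.toReal_zero]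
    have h2 := (measureReal_mono (μ := P) hsub).trans (measureReal_union_le _ _)
    rw [hnull, add_zero, h.measureReal_forall_zero] at h2
    refine hc.le.trans (h2.trans ?_)
    rw [← Finset.sum_neg_distrib, Real.exp_sum]
    refine Finset.prod_le_prod (fun i _ => ?_) fun i _ => ?_
    · rw [← h.measureReal_zero]; exact measureReal_nonneg
    · linarith [Real.add_one_le_exp (-q i)]
  refine summable_of_sum_le h.prob_nonneg (c := ∑ i ∈ F₀, q i + 1) fun G => ?_
  have h1 : ∑ i ∈ G \ F₀, q i ≤ 1 := by
    by_contra! hcon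
    have h2 := hprod (G \ F₀) Finset.sdiff_disjoint
    have h3 : Real.exp (-∑ i ∈ G \ F₀, q i) ≤ Real.exp (-1) := Real.exp_le_exp.2 (by linarith)
    have h4 := Real.exp_neg_one_lt_d9
    linarith
  have h2 : ∑ i ∈ G, q i ≤ ∑ i ∈ F₀ ∪ G, q i :=
    Finset.sum_le_sum_of_subset_of_nonneg Finset.subset_union_right fun i _ _ => h.prob_nonneg i
  have h3 : ∑ i ∈ F₀ ∪ G, q i = ∑ i ∈ F₀, q i + ∑ i ∈ G \ F₀, q i := by
    rw [← Finset.sum_union Finset.disjoint_sdiff, Finset.union_sdiff_self_eq_union]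
  linarith

end IsBernoulliFamily

/-! ### Upper limits of events -/

theorem le_measureReal_limsup {Ω : Type*} [MeasurableSpace Ω] {P : Measure Ω}
    [IsProbabilityMeasure P]
    {E : ℕ → Set Ω} (hE : ∀ n, MeasurableSet (E n)) {c : ℝ} (hc : ∀ᶠ n in atTop, c ≤ P.real (E n)) :
    c ≤ P.real (limsup E atTop) := by
  have hanti : Antitone fun n => ⋃ i ≥ n, E i := fun m n hmn =>
    Set.biUnion_subset_biUnion_left fun i hi => hmn.trans hi
  have hlim := tendsto_measure_iInter_atTop (μ := P) (fun n =>
    (MeasurableSet.iUnion fun i => MeasurableSet.iUnion fun (_ : i ≥ n) => hE i).nullMeasurableSet)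
    hanti ⟨0, measure_ne_top _ _⟩
  have hlim' := (ENNReal.tendsto_toReal (measure_ne_top _ _)).comp hlim
  have heq : limsup E atTop = ⋂ n, ⋃ i ≥ n, E i := by
    simp [limsup_eq_iInf_iSup_of_nat]
  rw [heq]
  refine ge_of_tendsto hlim' ?_
  filter_upwards [hc] with n hn
  exact hn.trans (measureReal_mono (Set.subset_biUnion_of_mem (u := E) (Set.mem_Ici.2 le_rfl))
    (measure_ne_top _ _))

/-- **Kolmogorov's zero-one law** for a Bernoulli family: an upper limit of events each depending
on fewer and fewer terms has probability `0` or `1`. -/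
theorem IsBernoulliFamily.measure_limsup_zero_or_one {ι Ω : Type*} {J : ι → Ω → ℝ} {q : ι → ℝ}
    [MeasurableSpace Ω] {P : Measure Ω} (h : IsBernoulliFamily J q P)
    {E : ℕ → Set Ω} {A : ℕ → Set ι} (hA : Antitone A)
    (hA0 : ∀ i, ∃ n, i ∉ A n) (hE : ∀ n, MeasurableSet[blockSigma J (A n)] (E n)) :
    P (limsup E atTop) = 0 ∨ P (limsup E atTop) = 1 := by
  classical
  refine measure_zero_or_one_of_measurableSet_limsup
    (s := fun i => MeasurableSpace.comap (J i) inferInstance) (f := cofinite)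
    (p := fun t : Set ι => t.Finite) (ns := fun F : Finset ι => (F : Set ι))
    (fun i => (h.measurable i).comap_le) h.indep.iIndep (fun t ht => ht.compl_mem_cofinite)
    (Monotone.directed_le fun F G hFG => Finset.coe_subset.2 hFG) (fun F => F.finite_toSet)
    (fun i => ⟨{i}, by simp⟩) ?_
  rw [limsup_eq_iInf_iSup, MeasurableSpace.measurableSet_iInf]
  intro B
  rw [MeasurableSpace.measurableSet_iInf]
  intro hB
  change MeasurableSet[blockSigma J B] _
  -- only finitely many terms lie outside `B`, and late events do not depend on them
  obtain ⟨n, hn⟩ : ∃ n, A n ⊆ B := by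
    choose f hf using hA0
    refine ⟨(mem_cofinite.1 hB).toFinset.sup f, fun i hi => ?_⟩
    by_contra hiB
    exact hf i (hA (Finset.le_sup (f := f) ((mem_cofinite.1 hB).mem_toFinset.2 hiB)) hi)
  rw [← limsup_nat_add E n]
  let _ := blockSigma J B
  refine MeasurableSet.measurableSet_limsup fun k => ?_
  exact blockSigma_mono ((hA (Nat.le_add_left n k)).trans hn) _ (hE (k + n))

/-! ### Gaps between selected primes -/

/-- The selected primes between `log₂ N` and `N` have product at most `N ^ 4`, and no prime in
`(N, N ^ K]` is selected. Leaving out the primes up to `log₂ N` makes the upper limit of these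
events a tail event; those primes contribute at most a factor `N ^ 2` to the product anyway. -/
def gapEvent {Ω : Type*} (J : Nat.Primes → Ω → ℝ) (K N : ℕ) : Set Ω :=
  {ω | ∑ p ∈ primesIoc (Nat.log 2 N) N, J p ω * Real.log (p : ℕ) ≤ 4 * Real.log N} ∩
    {ω | ∀ p ∈ primesIoc N (N ^ K), J p ω = 0}

/-- Intervals of length `N ^ (-8)` to the right of the points `∑_{p ∣ n} p ^ (-s)` with
`n ≤ N ^ 6`. -/
noncomputable def primeCover (s : ℝ) (N : ℕ) : Set ℝ :=
  ⋃ n ∈ Finset.range (N ^ 6 + 1), Set.Icc (∑ p ∈ n.primeFactors, ((p : ℝ) ^ s)⁻¹)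
    (∑ p ∈ n.primeFactors, ((p : ℝ) ^ s)⁻¹ + ((N : ℝ) ^ 8)⁻¹)

theorem measurableSet_primeCover (s : ℝ) (N : ℕ) : MeasurableSet (primeCover s N) :=
  Finset.measurableSet_biUnion _ fun _ _ => measurableSet_Icc

/-- The `N`-th cover has length at most `(N ^ 6 + 1) * N ^ (-8) ≤ 2 * N ^ (-2)`, which is
summable. -/
theorem volume_limsup_primeCover (s : ℝ) : volume (limsup (primeCover s) atTop) = 0 := by
  refine measure_limsup_atTop_eq_zero ?_
  have hsum : Summable fun N : ℕ => 2 * (1 / (N : ℝ) ^ 2) :=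
    (Real.summable_one_div_nat_pow.2 (by norm_num)).mul_left 2
  refine ne_top_of_le_ne_top hsum.tsum_ofReal_ne_top (ENNReal.tsum_le_tsum fun N => ?_)
  refine (measure_biUnion_finset_le _ _).trans ?_
  simp only [Real.volume_Icc, add_sub_cancel_left, Finset.sum_const, Finset.card_range,
    nsmul_eq_mul]
  rw [← ENNReal.ofReal_natCast, ← ENNReal.ofReal_mul (Nat.cast_nonneg _)]
  refine ENNReal.ofReal_le_ofReal ?_
  rcases Nat.eq_zero_or_pos N with rfl | hN
  · simp
  · have hN1 : (1 : ℝ) ≤ N := by exact_mod_cast hN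
    have h6 : (1 : ℝ) ≤ (N : ℝ) ^ 6 := one_le_pow₀ hN1
    push_cast
    rw [← div_eq_mul_inv, mul_one_div, div_le_div_iff₀ (by positivity) (by positivity)]
    nlinarith [show (0 : ℝ) ≤ (N : ℝ) ^ 2 by positivity,
      show (N : ℝ) ^ 8 = (N : ℝ) ^ 6 * (N : ℝ) ^ 2 by ring]

theorem measurableSet_gapEvent {Ω : Type*} (J : Nat.Primes → Ω → ℝ) (K N : ℕ) :
    MeasurableSet[blockSigma J {p | Nat.log 2 N < (p : ℕ)}] (gapEvent J K N) := by
  let _ := blockSigma J {p | Nat.log 2 N < (p : ℕ)}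
  refine MeasurableSet.inter (measurableSet_le (Finset.measurable_sum _ fun p hp => ?_)
    measurable_const) ?_
  · exact (measurable_blockSigma (A := {p : Nat.Primes | Nat.log 2 N < (p : ℕ)})
      (mem_primesIoc.1 hp).1).mul_const _
  · have : {ω | ∀ p ∈ primesIoc N (N ^ K), J p ω = 0} =
        ⋂ p ∈ primesIoc N (N ^ K), {ω | J p ω = 0} := by ext; simp
    rw [this]
    exact Finset.measurableSet_biInter _ fun p hp => measurableSet_blockSigma_eq
      (A := {p : Nat.Primes | Nat.log 2 N < (p : ℕ)})
      ((Nat.log_le_self 2 N).trans_lt (mem_primesIoc.1 hp).1) 0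

theorem Real.exp_neg_two_mul_le_one_sub {x : ℝ} (hx0 : 0 ≤ x) (hx : x ≤ 1 / 2) :
    Real.exp (-(2 * x)) ≤ 1 - x := by
  rw [Real.exp_neg]
  refine inv_le_of_inv_le₀ (by linarith) ?_
  refine le_trans ?_ (Real.add_one_le_exp (2 * x))
  rw [inv_le_iff_one_le_mul₀ (by linarith)]
  nlinarith

section
variable {Ω : Type*} [MeasurableSpace Ω] {P : Measure Ω} [IsProbabilityMeasure P]
  {J : Nat.Primes → Ω → ℝ}

/-- The lower bound does not depend on `N`. Markov's inequality for `∑ log p / p ≤ 2 log N` bounds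
the first condition, `∑_{N < p ≤ N ^ K} 1 / p ≤ 2 K` the second, and the two are independent. -/
theorem le_measureReal_gapEvent (h : IsBernoulliFamily J (fun p => 1 / ((p : ℕ) : ℝ)) P) (K : ℕ)
    {N : ℕ} (hN : 2 ≤ N) : 1 / 2 * Real.exp (-(4 * K)) ≤ P.real (gapEvent J K N) := by
  have hlogN : 0 < Real.log N := Real.log_pos (by exact_mod_cast hN)
  set F := primesIoc (Nat.log 2 N) N with hF
  set E₁ := {ω | ∑ p ∈ F, J p ω * Real.log (p : ℕ) ≤ 4 * Real.log N} with hE₁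
  set E₂ := {ω | ∀ p ∈ primesIoc N (N ^ K), J p ω = 0} with hE₂
  have hm₁ : MeasurableSet[blockSigma J {p | (p : ℕ) ≤ N}] E₁ := by
    let _ := blockSigma J {p | (p : ℕ) ≤ N}
    exact measurableSet_le (Finset.measurable_sum _ fun p hp =>
      (measurable_blockSigma (A := {p : Nat.Primes | (p : ℕ) ≤ N})
        (mem_primesIoc.1 hp).2).mul_const _) measurable_const
  have hm₂ : MeasurableSet[blockSigma J {p | N < (p : ℕ)}] E₂ := by
    let _ := blockSigma J {p | N < (p : ℕ)}
    have : E₂ = ⋂ p ∈ primesIoc N (N ^ K), {ω | J p ω = 0} := by ext; simp [hE₂]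
    rw [this]
    exact Finset.measurableSet_biInter _ fun p hp => measurableSet_blockSigma_eq
      (A := {p : Nat.Primes | N < (p : ℕ)}) (mem_primesIoc.1 hp).1 0
  have hind := h.indep_blockSigma (A := {p : Nat.Primes | (p : ℕ) ≤ N})
    (B := {p : Nat.Primes | N < (p : ℕ)})
    (Set.disjoint_left.2 fun p hp hp' => not_le.2 (show N < (p : ℕ) from hp') hp)
  have hmul : P.real (gapEvent J K N) = P.real E₁ * P.real E₂ := by
    rw [measureReal_def, measureReal_def, measureReal_def, ← ENNReal.toReal_mul,
      ← (Indep_iff _ _ _).1 hind E₁ E₂ hm₁ hm₂]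
    rfl
  have h₁ : 1 / 2 ≤ P.real E₁ := by
    have hsub : E₁ᶜ ⊆ {ω | 4 * Real.log N ≤
        subSeries J (fun p => Real.log (p : ℕ)) (F : Set Nat.Primes) ω} := by
      intro ω hω
      have h1 : subSeries J (fun p => Real.log (p : ℕ)) (F : Set Nat.Primes) ω =
          ∑ p ∈ F, J p ω * Real.log (p : ℕ) := by
        rw [subSeries, sum_eq_tsum_indicator]
      rw [Set.mem_ofPred_eq, h1]
      exact le_of_not_ge hω
    have h1 := (measureReal_mono (μ := P) hsub).trans (h.measureReal_le_subSeries_le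
      (fun p => Real.log_natCast_nonneg (p : ℕ)) (F : Set Nat.Primes)
      (summable_of_hasFiniteSupport (F.finite_toSet.subset Set.support_indicator_subset))
      (by positivity))
    rw [← sum_eq_tsum_indicator] at h1
    have h2 : ∑ p ∈ F, 1 / ((p : ℕ) : ℝ) * Real.log (p : ℕ) ≤ 2 * Real.log N := by
      refine le_of_eq_of_le (Finset.sum_congr rfl fun p _ => ?_)
        (sum_log_primesIoc_le (Nat.log 2 N) N)
      ring
    have h3 : (∑ p ∈ F, 1 / ((p : ℕ) : ℝ) * Real.log (p : ℕ)) / (4 * Real.log N) ≤ 1 / 2 := by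
      rw [div_le_iff₀ (by positivity)]
      linarith
    rw [probReal_compl_eq_one_sub (h.blockSigma_le _ _ hm₁)] at h1
    linarith
  have h₂ : Real.exp (-(4 * K)) ≤ P.real E₂ := by
    rw [hE₂, h.measureReal_forall_zero]
    calc Real.exp (-(4 * K))
        ≤ Real.exp (∑ p ∈ primesIoc N (N ^ K), -(2 * (1 / ((p : ℕ) : ℝ)))) := by
          rw [Real.exp_le_exp, Finset.sum_neg_distrib, ← Finset.mul_sum,
            sum_primesIoc N (N ^ K) fun p => 1 / (p : ℝ)]
          linarith [sum_inv_primes_Ioc_pow_le hN K]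
      _ ≤ _ := by
          rw [Real.exp_sum]
          refine Finset.prod_le_prod (fun p _ => (Real.exp_pos _).le) fun p _ => ?_
          refine Real.exp_neg_two_mul_le_one_sub (by positivity) ?_
          exact one_div_le_one_div_of_le (by norm_num) (by exact_mod_cast p.2.two_le)
  rw [hmul]
  exact mul_le_mul h₁ h₂ (Real.exp_pos _).le (by linarith)

theorem ae_frequently_mem_gapEvent (h : IsBernoulliFamily J (fun p => 1 / ((p : ℕ) : ℝ)) P)
    (K : ℕ) : ∀ᵐ ω ∂P, ∃ᶠ N in atTop, ω ∈ gapEvent J K N := by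
  have hmeas : ∀ N, MeasurableSet (gapEvent J K N) := fun N =>
    h.blockSigma_le _ _ (measurableSet_gapEvent J K N)
  have hpos : 0 < P.real (limsup (gapEvent J K) atTop) :=
    lt_of_lt_of_le (by positivity) (le_measureReal_limsup hmeas
      (eventually_atTop.2 ⟨2, fun N hN => le_measureReal_gapEvent h K hN⟩))
  have h01 := h.measure_limsup_zero_or_one (E := gapEvent J K)
    (A := fun N => {p | Nat.log 2 N < (p : ℕ)})
    (fun m n hmn p hp => (Nat.log_mono_right hmn).trans_lt hp)
    (fun p => ⟨2 ^ (p : ℕ), by simp [Nat.log_pow]⟩) (measurableSet_gapEvent J K)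
  have h1 : P (limsup (gapEvent J K) atTop) = 1 :=
    h01.resolve_left fun h0 => hpos.ne' (by rw [measureReal_def, h0, ENNReal.toReal_zero])
  have h2 : ∀ᵐ ω ∂P, ω ∈ limsup (gapEvent J K) atTop :=
    (mem_ae_iff_prob_eq_one (MeasurableSet.measurableSet_limsup hmeas)).2 h1
  filter_upwards [h2] with ω hω
  exact mem_limsup_iff_frequently_mem.1 hω

/-- Markov's inequality bounds the probability of the `N`-th exception by a multiple of
`N ^ (-2)`, so the Borel–Cantelli lemma applies. -/
theorem ae_eventually_tail_lt (h : IsBernoulliFamily J (fun p => 1 / ((p : ℕ) : ℝ)) P)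
    {s : ℝ} (hs : 0 < s) {K : ℕ} (hK : 20 ≤ K * s) :
    ∀ᵐ ω ∂P, ∀ᶠ N : ℕ in atTop,
      subSeries J (fun p => (((p : ℕ) : ℝ) ^ s)⁻¹) {p | N ^ K < (p : ℕ)} ω < ((N : ℝ) ^ 8)⁻¹ := by
  have hC : Summable fun p : Nat.Primes => ((p : ℕ) : ℝ) ^ (-(1 + s / 2)) :=
    Nat.Primes.summable_rpow.2 (by linarith)
  set C := ∑' p : Nat.Primes, ((p : ℕ) : ℝ) ^ (-(1 + s / 2)) with hCdef
  have ha : ∀ p : Nat.Primes, 0 ≤ (((p : ℕ) : ℝ) ^ s)⁻¹ := fun p => by positivity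
  have hterm : ∀ N : ℕ, 1 ≤ N → ∀ p : Nat.Primes,
      ({p : Nat.Primes | N ^ K < (p : ℕ)}.indicator
        fun p => 1 / ((p : ℕ) : ℝ) * (((p : ℕ) : ℝ) ^ s)⁻¹) p ≤
      ((p : ℕ) : ℝ) ^ (-(1 + s / 2)) * ((N : ℝ) ^ 10)⁻¹ := by
    intro N hN p
    refine Set.indicator_apply_le' (fun hp => ?_) fun _ => by positivity
    have hN1 : (1 : ℝ) ≤ N := by exact_mod_cast hN
    have hp0 : (0 : ℝ) < ((p : ℕ) : ℝ) := by exact_mod_cast p.2.pos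
    have h1 : 1 / ((p : ℕ) : ℝ) * (((p : ℕ) : ℝ) ^ s)⁻¹ =
        ((p : ℕ) : ℝ) ^ (-(1 + s / 2)) * (((p : ℕ) : ℝ) ^ (s / 2))⁻¹ := by
      rw [one_div, ← Real.rpow_neg_one, ← Real.rpow_neg hp0.le, ← Real.rpow_neg hp0.le,
        ← Real.rpow_add hp0, ← Real.rpow_add hp0]
      congr 1
      ring
    rw [h1]
    -- half of the exponent `s` is spent on smallness, the other half keeps the sum convergent
    have h2 : (N : ℝ) ^ 10 ≤ ((p : ℕ) : ℝ) ^ (s / 2) := by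
      calc (N : ℝ) ^ 10 = (N : ℝ) ^ (10 : ℝ) := by norm_cast
        _ ≤ (N : ℝ) ^ (K * (s / 2)) := Real.rpow_le_rpow_of_exponent_le hN1 (by linarith)
        _ = ((N ^ K : ℕ) : ℝ) ^ (s / 2) := by
            rw [Real.rpow_mul (by positivity), Real.rpow_natCast, Nat.cast_pow]
        _ ≤ _ := Real.rpow_le_rpow (by positivity)
            (by exact_mod_cast (show N ^ K < (p : ℕ) from hp).le) (by positivity)
    gcongr
  have hnn : ∀ (N : ℕ) (p : Nat.Primes), 0 ≤ ({p : Nat.Primes | N ^ K < (p : ℕ)}.indicator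
      fun p => 1 / ((p : ℕ) : ℝ) * (((p : ℕ) : ℝ) ^ s)⁻¹) p := fun N p =>
    Set.indicator_nonneg (fun p _ => by positivity) p
  have hprob : ∀ N : ℕ, 1 ≤ N → P.real {ω | ((N : ℝ) ^ 8)⁻¹ ≤
      subSeries J (fun p => (((p : ℕ) : ℝ) ^ s)⁻¹) {p | N ^ K < (p : ℕ)} ω} ≤
      C * (1 / (N : ℝ) ^ 2) := by
    intro N hN
    have hN0 : (0 : ℝ) < N := by exact_mod_cast hN
    have hsum := Summable.of_nonneg_of_le (hnn N) (hterm N hN) (hC.mul_right _)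
    refine (h.measureReal_le_subSeries_le ha _ hsum (by positivity)).trans ?_
    have h1 : ∑' p, ({p : Nat.Primes | N ^ K < (p : ℕ)}.indicator
        fun p => 1 / ((p : ℕ) : ℝ) * (((p : ℕ) : ℝ) ^ s)⁻¹) p ≤ C * ((N : ℝ) ^ 10)⁻¹ := by
      rw [hCdef, ← tsum_mul_right]
      exact hsum.tsum_le_tsum (hterm N hN) (hC.mul_right _)
    rw [div_le_iff₀ (by positivity)]
    refine h1.trans_eq ?_
    field_simp
  -- the index is shifted since the bound fails at `N = 0`
  have hBC : ∑' N : ℕ, P {ω | ((((N + 1 : ℕ)) : ℝ) ^ 8)⁻¹ ≤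
      subSeries J (fun p => (((p : ℕ) : ℝ) ^ s)⁻¹) {p | (N + 1) ^ K < (p : ℕ)} ω} ≠ ∞ := by
    have hsum : Summable fun N : ℕ => C * (1 / ((N + 1 : ℕ) : ℝ) ^ 2) :=
      ((summable_nat_add_iff 1).2 (Real.summable_one_div_nat_pow.2 (by norm_num))).mul_left C
    refine ne_top_of_le_ne_top hsum.tsum_ofReal_ne_top (ENNReal.tsum_le_tsum fun N => ?_)
    rw [← ofReal_measureReal]
    exact ENNReal.ofReal_le_ofReal (hprob (N + 1) (by lia))
  filter_upwards [ae_eventually_notMem hBC] with ω hω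
  obtain ⟨m, hm⟩ := eventually_atTop.1 hω
  refine eventually_atTop.2 ⟨m + 1, fun N hN => ?_⟩
  obtain ⟨k, rfl⟩ := Nat.exists_eq_add_of_le' (le_of_add_le_right hN)
  exact not_le.1 (hm k (by lia))

end

/-- On the gap event, the primes up to `N ^ K` contribute `∑_{p ∣ n} p ^ (-s)`, with `n ≤ N ^ 6`
the product of the selected primes, and the tail is too short to leave the interval there. -/
theorem tsum_mem_primeCover {Ω : Type*} {J : Nat.Primes → Ω → ℝ} {s : ℝ} {K N : ℕ} (hK : 1 ≤ K)
    (hN : 2 ≤ N) {ω : Ω} (h01 : ∀ p, J p ω = 0 ∨ J p ω = 1)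
    (hsum : Summable fun p : Nat.Primes => J p ω * (((p : ℕ) : ℝ) ^ s)⁻¹)
    (hgap : ω ∈ gapEvent J K N)
    (htail : subSeries J (fun p => (((p : ℕ) : ℝ) ^ s)⁻¹) {p | N ^ K < (p : ℕ)} ω <
      ((N : ℝ) ^ 8)⁻¹) :
    ∑' p : Nat.Primes, J p ω * (((p : ℕ) : ℝ) ^ s)⁻¹ ∈ primeCover s N := by
  classical
  have hNK : N ≤ N ^ K := Nat.le_self_pow (by lia) N
  set R := subSeries J (fun p => (((p : ℕ) : ℝ) ^ s)⁻¹) {p | N ^ K < (p : ℕ)} ω with hR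
  have hR0 : 0 ≤ R := tsum_nonneg fun p => Set.indicator_nonneg (fun p _ =>
    mul_nonneg (by rcases h01 p with h | h <;> simp [h]) (by positivity)) p
  set A := (primesIoc 0 N).filter fun p => J p ω = 1 with hA
  have hsumA : ∀ f : Nat.Primes → ℝ, ∑ p ∈ primesIoc 0 N, J p ω * f p = ∑ p ∈ A, f p := by
    intro f
    rw [hA, Finset.sum_filter]
    refine Finset.sum_congr rfl fun p _ => ?_
    rcases h01 p with h | h <;> simp [h]
  set B : Finset ℕ := A.image fun p : Nat.Primes => (p : ℕ) with hB
  have hinj : Set.InjOn (fun p : Nat.Primes => (p : ℕ)) A := fun p _ q _ h => Subtype.ext h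
  have hBp : ∀ p ∈ B, p.Prime := by
    intro p hp
    obtain ⟨q, _, rfl⟩ := Finset.mem_image.1 hp
    exact q.2
  have hfac : (∏ p ∈ B, p).primeFactors = B := Nat.primeFactors_prod hBp
  have hn0 : 0 < ∏ p ∈ B, p := Finset.prod_pos fun p hp => (hBp p hp).pos
  have hn : ∏ p ∈ B, p ≤ N ^ 6 := by
    have h1 : Real.log ((∏ p ∈ B, p : ℕ) : ℝ) = ∑ p ∈ A, Real.log (p : ℕ) := by
      rw [Nat.cast_prod, Real.log_prod fun p hp => Nat.cast_ne_zero.2 (hBp p hp).ne_zero,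
        hB, Finset.sum_image hinj]
    have hunion : primesIoc 0 N = primesIoc 0 (Nat.log 2 N) ∪ primesIoc (Nat.log 2 N) N := by
      ext p
      have := Nat.log_le_self 2 N
      simp only [Finset.mem_union, mem_primesIoc]
      lia
    have hdisj : Disjoint (primesIoc 0 (Nat.log 2 N)) (primesIoc (Nat.log 2 N) N) :=
      Finset.disjoint_left.2 fun p hp hp' =>
        absurd (mem_primesIoc.1 hp).2 (not_le.2 (mem_primesIoc.1 hp').1)
    have h2 : ∑ p ∈ primesIoc 0 (Nat.log 2 N), J p ω * Real.log (p : ℕ) ≤ 2 * Real.log N := by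
      refine (Finset.sum_le_sum fun p _ => ?_).trans (sum_log_primesIoc_log_le (by lia))
      have := Real.log_natCast_nonneg (p : ℕ)
      rcases h01 p with h | h <;> simp [h, this]
    have h3 : ∑ p ∈ primesIoc (Nat.log 2 N) N, J p ω * Real.log (p : ℕ) ≤ 4 * Real.log N := hgap.1
    rw [← hsumA fun p => Real.log (p : ℕ), hunion, Finset.sum_union hdisj] at h1
    have h4 : Real.log ((∏ p ∈ B, p : ℕ) : ℝ) ≤ Real.log ((N ^ 6 : ℕ) : ℝ) := by
      rw [h1, Nat.cast_pow, Real.log_pow]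
      push_cast
      linarith
    exact_mod_cast (Real.log_le_log_iff (by exact_mod_cast hn0) (by positivity)).1 h4
  have hT : subSeries J (fun p => (((p : ℕ) : ℝ) ^ s)⁻¹) {p | N ^ K < (p : ℕ)}ᶜ ω =
      ∑ p ∈ (∏ p ∈ B, p).primeFactors, ((p : ℝ) ^ s)⁻¹ := by
    rw [hfac, hB, Finset.sum_image hinj, ← hsumA fun p => (((p : ℕ) : ℝ) ^ s)⁻¹, subSeries,
      tsum_eq_sum (s := primesIoc 0 N)]
    · refine Finset.sum_congr rfl fun p hp => Set.indicator_of_mem ?_ _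
      exact not_lt.2 ((mem_primesIoc.1 hp).2.trans hNK)
    · intro p hp
      refine Set.indicator_apply_eq_zero.2 fun hp' => ?_
      have hpN : N < (p : ℕ) := by
        by_contra! hcon
        exact hp (mem_primesIoc.2 ⟨p.2.pos, hcon⟩)
      rw [hgap.2 p (mem_primesIoc.2 ⟨hpN, not_lt.1 hp'⟩), zero_mul]
  have hS := subSeries_add_compl hsum {p : Nat.Primes | N ^ K < (p : ℕ)}
  rw [hT, ← hR] at hS
  rw [primeCover, Set.mem_iUnion₂]
  refine ⟨∏ p ∈ B, p, Finset.mem_range.2 (by lia), ?_, ?_⟩ <;> linarith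

theorem IsBernoulliFamily.ae_mem_limsup_primeCover {Ω : Type*} [MeasurableSpace Ω] {P : Measure Ω}
    [IsProbabilityMeasure P] {J : Nat.Primes → Ω → ℝ}
    (h : IsBernoulliFamily J (fun p => 1 / ((p : ℕ) : ℝ)) P) {s : ℝ} (hs : 0 < s)
    (hsum : ∀ᵐ ω ∂P, Summable fun p : Nat.Primes => J p ω * (((p : ℕ) : ℝ) ^ s)⁻¹) :
    ∀ᵐ ω ∂P, ∑' p : Nat.Primes, J p ω * (((p : ℕ) : ℝ) ^ s)⁻¹ ∈ limsup (primeCover s) atTop := by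
  obtain ⟨K, hK⟩ := exists_nat_ge (20 / s)
  have hK20 : 20 ≤ K * s := (div_le_iff₀ hs).1 hK
  have hK1 : 1 ≤ K := Nat.one_le_iff_ne_zero.2 fun h0 => by norm_num [h0] at hK20
  filter_upwards [ae_frequently_mem_gapEvent h K, ae_eventually_tail_lt h hs hK20, hsum]
    with ω hgap htail hω
  refine mem_limsup_iff_frequently_mem.2
    ((hgap.and_eventually (htail.and (eventually_ge_atTop 2))).mono fun N hN => ?_)
  exact tsum_mem_primeCover hK1 hN.2.2 (fun p => h.zero_or_one p ω) hω hN.1 hN.2.1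

/-! ### The law of the prime series -/

/-- Variables with Bernoulli laws need only be a.e. measurable and a.s. two-valued; they agree
almost surely with a family for which both hold everywhere. -/
theorem exists_isBernoulliFamily_ae_eq {ι Ω : Type*} [MeasurableSpace Ω] {P : Measure Ω}
    [IsProbabilityMeasure P] {I : ι → Ω → ℝ} {q : ι → unitInterval}
    (hlaw : ∀ i, HasLaw (I i) (bernoulliMeasure (1 : ℝ) 0 (q i)) P) (hindep : iIndepFun I P) :
    ∃ J : ι → Ω → ℝ, IsBernoulliFamily J (fun i => (q i : ℝ)) P ∧ ∀ i, I i =ᵐ[P] J i := by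
  classical
  have hφ : Measurable fun x : ℝ => if x = 1 then (1 : ℝ) else 0 :=
    Measurable.ite (measurableSet_singleton 1) measurable_const measurable_const
  have hmk : ∀ i, Measurable ((hlaw i).aemeasurable.mk (I i)) := fun i =>
    (hlaw i).aemeasurable.measurable_mk
  have hae : ∀ i, I i =ᵐ[P] fun ω =>
      if (hlaw i).aemeasurable.mk (I i) ω = 1 then (1 : ℝ) else 0 := by
    intro i
    have hset : MeasurableSet ({0, 1} : Set ℝ)ᶜ := (Set.toFinite _).measurableSet.compl
    have h1 : P (I i ⁻¹' ({0, 1} : Set ℝ)ᶜ) = 0 := by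
      rw [← Measure.map_apply_of_aemeasurable (hlaw i).aemeasurable hset, (hlaw i).map_eq,
        bernoulliMeasure_apply_of_notMem_of_notMem _ hset (by simp) (by simp)]
    have h2 : ∀ᵐ ω ∂P, I i ω ∈ ({0, 1} : Set ℝ) := by
      rw [ae_iff]; exact h1
    filter_upwards [h2, (hlaw i).aemeasurable.ae_eq_mk] with ω h3 h4
    rw [← h4]
    rcases h3 with h3 | h3
    · simp [h3]
    · simp [show I i ω = 1 from h3]
  refine ⟨fun i ω => if (hlaw i).aemeasurable.mk (I i) ω = 1 then 1 else 0,
    ⟨fun i => hφ.comp (hmk i), fun i ω => ?_, fun i => ?_, hindep.congr hae⟩, hae⟩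
  · by_cases h : (hlaw i).aemeasurable.mk (I i) ω = 1 <;> simp [h]
  · have h1 : P.real {ω | (if (hlaw i).aemeasurable.mk (I i) ω = 1 then (1 : ℝ) else 0) = 1} =
        P.real (I i ⁻¹' {1}) := by
      refine measureReal_congr (eventuallyEq_set.2 ?_)
      filter_upwards [hae i] with ω hω
      rw [← hω]
      rfl
    rw [h1, measureReal_def, ← Measure.map_apply_of_aemeasurable (hlaw i).aemeasurable
      (measurableSet_singleton 1), (hlaw i).map_eq, ← measureReal_def,
      bernoulliMeasure_real_apply_of_mem_of_notMem _ (measurableSet_singleton 1) (by simp)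
      (by simp)]

theorem mainTheorem2 {Ω : Type*} [MeasurableSpace Ω] (P : Measure Ω) [IsProbabilityMeasure P]
    (I : Nat.Primes → Ω → ℝ)
    (hlaw : ∀ p, HasLaw (I p) (bernoulliMeasure (1 : ℝ) 0 (primeProb p)) P)
    (hindep : iIndepFun I P) (s : ℝ) (hs : 0 < s) :
    (∀ᵐ ω ∂P, Summable fun p : Nat.Primes => I p ω / ((p : ℕ) : ℝ) ^ s) ∧
      AEMeasurable (primeSeries I s) P ∧
      (∀ x : ℝ, P.map (primeSeries I s) {x} = 0) ∧
      P.map (primeSeries I s) ⟂ₘ (volume : Measure ℝ) := by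
  obtain ⟨J, hJ, hIJ⟩ := exists_isBernoulliFamily_ae_eq hlaw hindep
  replace hJ : IsBernoulliFamily J (fun p => 1 / ((p : ℕ) : ℝ)) P := hJ
  have hpos : ∀ p : Nat.Primes, 0 < (((p : ℕ) : ℝ) ^ s)⁻¹ := fun p =>
    inv_pos.2 (Real.rpow_pos_of_pos (by exact_mod_cast p.2.pos) s)
  have hqa : Summable fun p : Nat.Primes => 1 / ((p : ℕ) : ℝ) * (((p : ℕ) : ℝ) ^ s)⁻¹ := by
    refine (Nat.Primes.summable_rpow.2 (show -(1 + s) < -1 by linarith)).congr fun p => ?_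
    have hp0 : (0 : ℝ) < ((p : ℕ) : ℝ) := by exact_mod_cast p.2.pos
    rw [Real.rpow_neg hp0.le, Real.rpow_add hp0, Real.rpow_one, mul_inv, one_div]
  have hq : ¬ Summable fun p : Nat.Primes => 1 / ((p : ℕ) : ℝ) := by
    simpa [one_div] using Nat.Primes.not_summable_one_div
  have hq0 : Tendsto (fun p : Nat.Primes => 1 / ((p : ℕ) : ℝ)) cofinite (𝓝 0) := by
    have h1 : Tendsto (fun p : Nat.Primes => (p : ℕ)) cofinite atTop := by
      rw [← Nat.cofinite_eq_atTop]
      exact (show Function.Injective fun p : Nat.Primes => (p : ℕ) from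
        Subtype.val_injective).tendsto_cofinite
    exact tendsto_one_div_atTop_nhds_zero_nat.comp h1
  have hIJ' : ∀ᵐ ω ∂P, ∀ p, I p ω = J p ω := ae_all_iff.2 hIJ
  have hsumJ := hJ.ae_summable (fun p => (hpos p).le) hqa
  have hSm : Measurable fun ω => ∑' p : Nat.Primes, J p ω * (((p : ℕ) : ℝ) ^ s)⁻¹ :=
    Measurable.tsum fun p => (hJ.measurable p).mul_const _
  have hS : primeSeries I s =ᵐ[P] fun ω => ∑' p : Nat.Primes, J p ω * (((p : ℕ) : ℝ) ^ s)⁻¹ := by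
    filter_upwards [hIJ'] with ω hω
    exact tsum_congr fun p => by rw [hω p, div_eq_mul_inv]
  refine ⟨?_, ⟨_, hSm, hS⟩, fun x => ?_, ?_⟩
  · filter_upwards [hIJ', hsumJ] with ω hω hsum
    exact hsum.congr fun p => by rw [hω p, div_eq_mul_inv]
  · rw [Measure.map_congr hS, Measure.map_apply hSm (measurableSet_singleton x)]
    exact (measureReal_eq_zero_iff (measure_ne_top _ _)).1
      (hJ.measureReal_tsum_eq_zero hpos hqa hq hq0 x)
  · have hB : MeasurableSet (limsup (primeCover s) atTop) :=
      MeasurableSet.measurableSet_limsup (measurableSet_primeCover s)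
    rw [Measure.map_congr hS]
    refine ⟨(limsup (primeCover s) atTop)ᶜ, hB.compl, ?_, ?_⟩
    · rw [Measure.map_apply hSm hB.compl]
      exact mem_ae_iff.1 (hJ.ae_mem_limsup_primeCover hs hsumJ)
    · rw [compl_compl]
      exact volume_limsup_primeCover s
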